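/- An edge-ordered graph is a finite graph, with at least one vertex, equipped with a total order of its edge set; $|G|$ denotes its number of vertices and $\delta(G)$ its minimum degree. A copy of an edge-ordered graph $F$ in an edge-ordered graph $G$ is a (not necessarily induced) subgraph $F'$ of $G$ for which there is a graph isomorphism from $F$ to $F'$ carrying the total order of $E(F)$ to the total order of $E(F')$ inherited from $E(G)$. A perfect $F$-tiling in $G$ is a collection of vertex-disjoint copies of $F$ in $G$ that together cover all vertices of $G$. Call $F$ tileable if there is a positive integer $t$ divisible by $|F|$ such that every edge-ordering of the complete graph $K_t$ contains a perfect $F$-tiling, and in this case let $T(F)$ be the smallest such $t$. **Theorem.** Let $F$ be a tileable edge-ordered graph. For every integer $n\ge T(F)$ divisible by $|F|$, every edge-ordered graph $G$ on $n$ vertices with $$\delta(G)\ \ge\ \Bigl(1-\frac{1}{T(F)}\Bigr)n$$ contains a perfect $F$-tiling. -/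

import Mathlib

/-- An edge-ordered graph on the vertex set `V`: a graph together with a total order of its
edge set. -/
structure EdgeOrderedGraph (V : Type*) where
  /-- The underlying graph. -/
  graph : SimpleGraph V
  /-- The total order of the edges. -/
  edgeOrder : LinearOrder graph.edgeSet

namespace EdgeOrderedGraph

/-- An injective homomorphism `φ` of the underlying graphs preserves the edge orders: if `e < e'`
in `F`, then the image of `e` is smaller than the image of `e'` in `G`. -/
def PreservesEdgeOrder {W V : Type*} (F : EdgeOrderedGraph W) (G : EdgeOrderedGraph V)
    (φ : SimpleGraph.Copy F.graph G.graph) : Prop :=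
  ∀ e e' : F.graph.edgeSet, F.edgeOrder.lt e e' →
    G.edgeOrder.lt (φ.toHom.mapEdgeSet e) (φ.toHom.mapEdgeSet e')

/-- The subgraph `H` of `G` is a copy of `F` in `G`: it is the image of `F` under an injective
homomorphism that preserves the edge orders, where the edges of `H` are ordered as in `G`. -/
def IsCopy {W V : Type*} (F : EdgeOrderedGraph W) (G : EdgeOrderedGraph V)
    (H : G.graph.Subgraph) : Prop :=
  ∃ φ : SimpleGraph.Copy F.graph G.graph, PreservesEdgeOrder F G φ ∧ φ.toSubgraph = H

/-- An `F`-tiling in `G`: a collection of vertex-disjoint copies of `F` in `G`. -/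
def IsTiling {W V : Type*} (F : EdgeOrderedGraph W) (G : EdgeOrderedGraph V)
    (𝒯 : Set G.graph.Subgraph) : Prop :=
  (∀ H ∈ 𝒯, IsCopy F G H) ∧ 𝒯.PairwiseDisjoint SimpleGraph.Subgraph.verts

/-- `G` contains a perfect `F`-tiling, that is, an `F`-tiling that covers all vertices of `G`. -/
def HasPerfectTiling {W V : Type*} (F : EdgeOrderedGraph W) (G : EdgeOrderedGraph V) : Prop :=
  ∃ 𝒯 : Set G.graph.Subgraph, IsTiling F G 𝒯 ∧ ∀ v : V, ∃ H ∈ 𝒯, v ∈ H.verts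

/-- The positive integers `t`, divisible by the number of vertices of `F`, such that every
edge-ordering of the complete graph `K_t` contains a perfect `F`-tiling. -/
def tilingOrders {W : Type*} [Fintype W] (F : EdgeOrderedGraph W) : Set ℕ :=
  {t | 0 < t ∧ Fintype.card W ∣ t ∧
    ∀ K : EdgeOrderedGraph (Fin t), K.graph = ⊤ → HasPerfectTiling F K}

/-- `F` is tileable if for some positive integer `t` divisible by `|F|`, every edge-ordering of
`K_t` contains a perfect `F`-tiling. -/
def Tileable {W : Type*} [Fintype W] (F : EdgeOrderedGraph W) : Prop :=
  (tilingOrders F).Nonempty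

/-- For a tileable `F`, the smallest `t` as in the definition of tileability. -/
noncomputable def tilingNumber {W : Type*} [Fintype W] (F : EdgeOrderedGraph W) : ℕ :=
  sInf (tilingOrders F)

end EdgeOrderedGraph

/-! Write t = T(F) and k = ⌊n/t⌋. For each vertex v, n − deg(v) is an integer at most n/t, so v has
fewer than k non-neighbours other than itself. The Hajnal–Szemerédi theorem, applied to the
complement, splits any kt vertices into k cliques of size t, and each clique is tiled by the choice
of t. The excess n − kt is a multiple of |F|: deleting one copy of F found in a clique does not
raise complement degrees, and repeating this leaves exactly kt vertices (`tilesSet_of_card`).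

Most of the work is Hajnal–Szemerédi, by the Kierstead–Kostochka argument. Induction on vertices and
edges yields a proper colouring whose classes have size s, except that class a is one short and
class b one over. Draw an arc i → j when some vertex of colour i has no neighbour of colour j, and
let A be the set of colours that reach a. If b ∈ A, shifting one vertex along each arc of a path
from b to a finishes the proof. Otherwise discharging (`exists_solo`) finds z coloured in A and y
coloured outside A such that z is the only neighbour of y in the class of z. Either z can move
within A, y replaces it, and the rest outside A is recoloured by induction
(`exists_isEquitable_of_swap`); or z moves out of A, y replaces it, and A grows
(`exists_near_of_not_free`). -/

namespace EquitableColoring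

open Finset Relation
open scoped Classical

/-! ### Reachability in digraphs -/

section Digraph

variable {κ : Type*} {r : κ → κ → Prop}

theorem exists_nodup_chain {i j : κ} (h : ReflTransGen r i j) :
    ∃ l : List κ, (i :: l).Nodup ∧ (i :: l).IsChain r ∧
      (i :: l).getLast (List.cons_ne_nil _ _) = j := by
  induction h using ReflTransGen.head_induction_on with
  | refl => exact ⟨[], by simp⟩
  | @head i k hik _ ih =>
    obtain ⟨l, hnd, hch, hl⟩ := ih
    by_cases hi : i ∈ k :: l
    · obtain ⟨p, q, hpq⟩ := List.append_of_mem hi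
      refine ⟨q, ?_, ?_, ?_⟩
      · rw [hpq] at hnd
        exact (List.nodup_append.1 hnd).2.1
      · rw [hpq] at hch
        exact hch.right_of_append
      · simp only [hpq] at hl
        rw [← hl]
        simp
    · refine ⟨k :: l, List.nodup_cons.2 ⟨hi, hnd⟩, List.isChain_cons_cons.2 ⟨hik, hch⟩, ?_⟩
      rw [List.getLast_cons_cons]
      exact hl

theorem isChain_tail_forall {P : κ → Prop} (hP : ∀ x y, r x y → P y) :
    ∀ (l : List κ) (i : κ), (i :: l).IsChain r → ∀ z ∈ l, P z
  | [], _, _ => by simp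
  | k :: l, i, h => by
    obtain ⟨h1, h2⟩ := List.isChain_cons_cons.1 h
    intro z hz
    rcases List.mem_cons.1 hz with rfl | hz
    · exact hP _ _ h1
    · exact isChain_tail_forall hP l k h2 z hz

/-- The relation `r` restricted to the elements other than `U`. -/
def Avoid (r : κ → κ → Prop) (U x y : κ) : Prop := r x y ∧ x ≠ U ∧ y ≠ U

/-- If a path meets `U`, the part after its last visit to `U` avoids `U`. -/
theorem reach_avoid_or {a x : κ} (U : κ) (h : ReflTransGen r x a) :
    ReflTransGen (Avoid r U) x a ∨ U = a ∨ ∃ k, k ≠ U ∧ r U k ∧ ReflTransGen (Avoid r U) k a := by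
  induction h using ReflTransGen.head_induction_on with
  | refl => exact Or.inl .refl
  | @head x k hxk _ ih =>
    rcases ih with ih | ih
    · by_cases hUa : U = a
      · exact Or.inr (Or.inl hUa)
      by_cases hk : k = U
      · rcases ReflTransGen.cases_head ih with h | ⟨_, h, _⟩
        · exact absurd (hk.symm.trans h) hUa
        · exact absurd hk h.2.1
      · by_cases hx : x = U
        · exact Or.inr (Or.inr ⟨k, hk, hx ▸ hxk, ih⟩)
        · exact Or.inl (ih.head ⟨hxk, hx, hk⟩)
    · exact Or.inr ih

/-- If the path avoiding `U` met `W`, its tail would lead from `W` to `a` avoiding `U`. -/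
theorem reach_avoid_of_not_reach {a U W x : κ} (hW : ¬ ReflTransGen (Avoid r U) W a)
    (h : ReflTransGen (Avoid r U) x a) : ReflTransGen (Avoid r W) x a := by
  induction h using ReflTransGen.head_induction_on with
  | refl => exact .refl
  | @head x k hxk hk ih =>
    refine ih.head ⟨hxk.1, ?_, ?_⟩
    · rintro rfl
      exact hW (hk.head hxk)
    · rintro rfl
      exact hW hk

/-- In a digraph in which all elements of `A` reach `a`, there is a nonempty block `T` of elements
whose removal does not disconnect any other element from `a`, and such that no edge leaves `T`
except possibly to a single element `U`. -/
theorem exists_terminal_block {a : κ} {A : Finset κ} (hA : ∀ x, x ∈ A ↔ ReflTransGen r x a)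
    (h2 : ∃ x ∈ A, x ≠ a) :
    ∃ U ∈ A, ∃ T ⊆ A, T.Nonempty ∧ U ∉ T ∧ a ∉ T ∧
      (∀ W ∈ T, ∀ x ∈ A, x ≠ W → ReflTransGen (Avoid r W) x a) ∧
      ∀ W ∈ T, ∀ X ∈ A, X ∉ T → X ≠ U → ¬ r W X := by
  let R : κ → Finset κ := fun U => A.filter fun x => x ≠ U ∧ ¬ ReflTransGen (Avoid r U) x a
  have hR : ∀ U x, x ∈ R U ↔ x ∈ A ∧ x ≠ U ∧ ¬ ReflTransGen (Avoid r U) x a := fun U x => by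
    simp [R]
  have haA : a ∈ A := (hA a).2 .refl
  have hne : (A.filter fun U => (R U).Nonempty).Nonempty := by
    -- No nontrivial path ending at `a` avoids `a`, so `R a` is `A` without `a`.
    refine ⟨a, mem_filter.2 ⟨haA, ?_⟩⟩
    obtain ⟨x, hx, hxa⟩ := h2
    refine ⟨x, (hR _ _).2 ⟨hx, hxa, fun h => ?_⟩⟩
    rcases ReflTransGen.cases_tail h with h | ⟨_, _, h⟩
    · exact hxa h.symm
    · exact h.2.2 rfl
  -- Take `T = R U` of least nonzero size. For `W ∈ T`, a nonempty `R W` would be a proper subset of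
  -- `R U`, since it misses `W`. An arc from `T` to some `X ∉ T`, `X ≠ U`, would let its source
  -- reach `a` avoiding `U`.
  obtain ⟨U, hU, hmin⟩ := exists_min_image _ (fun U => #(R U)) hne
  obtain ⟨hUA, hUne⟩ := mem_filter.1 hU
  refine ⟨U, hUA, R U, filter_subset _ _, hUne, fun h => ((hR _ _).1 h).2.1 rfl,
    fun h => ((hR _ _).1 h).2.2 .refl, ?_, ?_⟩
  · intro W hW x hx hxW
    obtain ⟨hWA, hWU, hWr⟩ := (hR _ _).1 hW
    by_contra hxr
    have hxR : x ∈ R W := (hR _ _).2 ⟨hx, hxW, hxr⟩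
    have hle := hmin W (mem_filter.2 ⟨hWA, x, hxR⟩)
    refine absurd hle (not_le.2 (card_lt_card ?_))
    refine (ssubset_iff_of_subset fun u hu => ?_).2 ⟨W, hW, fun h => ((hR _ _).1 h).2.1 rfl⟩
    obtain ⟨huA, huW, hur⟩ := (hR _ _).1 hu
    refine (hR _ _).2 ⟨huA, ?_, fun h => hur (reach_avoid_of_not_reach hWr h)⟩
    rintro rfl
    rcases reach_avoid_or u ((hA u).1 hUA) with h | h | ⟨k, hk, huk, h⟩
    · exact hur (reach_avoid_of_not_reach hWr h)
    · exact hur (h ▸ .refl)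
    · refine hur ((reach_avoid_of_not_reach hWr h).head ⟨huk, huW, ?_⟩)
      rintro rfl
      exact hWr h
  · intro W hW X hX hXT hXU hWX
    obtain ⟨hWA, hWU, hWr⟩ := (hR _ _).1 hW
    refine hXT ((hR _ _).2 ⟨hX, hXU, fun h => hWr (h.head ⟨hWX, hWU, hXU⟩)⟩)

end Digraph

/-! ### Colourings and moving vertices between classes -/

variable {V κ : Type*}

/-- The vertices of `S` of colour `i`. -/
noncomputable def cls (S : Finset V) (c : V → κ) (i : κ) : Finset V := S.filter fun v => c v = i

theorem mem_cls {S : Finset V} {c : V → κ} {i : κ} {v : V} :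
    v ∈ cls S c i ↔ v ∈ S ∧ c v = i := by simp [cls]

/-- The colouring `c` is proper on `S`. -/
def ProperOn (G : SimpleGraph V) (S : Finset V) (c : V → κ) : Prop :=
  ∀ v ∈ S, ∀ w ∈ S, G.Adj v w → c v ≠ c w

/-- The vertex `v` has no neighbour of colour `j` in `S`. -/
def Free (G : SimpleGraph V) (S : Finset V) (c : V → κ) (v : V) (j : κ) : Prop :=
  ∀ w ∈ S, G.Adj v w → c w ≠ j

/-- Some vertex of colour `i` has no neighbour of colour `j`. -/
def Step (G : SimpleGraph V) (S : Finset V) (c : V → κ) (i j : κ) : Prop :=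
  ∃ v ∈ S, c v = i ∧ Free G S c v j

/-- Indicators on both sides avoid subtraction and also cover `j = c v`. -/
theorem card_cls_update {S : Finset V} (c : V → κ) {v : V} (hv : v ∈ S) (j x : κ) :
    #(cls S (Function.update c v j) x) + (if x = c v then 1 else 0) =
      #(cls S c x) + if x = j then 1 else 0 := by
  unfold cls
  rw [card_filter, card_filter, ← add_sum_erase S _ hv, ← add_sum_erase S _ hv]
  have : ∑ w ∈ S.erase v, (if Function.update c v j w = x then 1 else 0) =
      ∑ w ∈ S.erase v, if c w = x then 1 else 0 := by
    refine sum_congr rfl fun w hw => ?_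
    rw [Function.update_of_ne (ne_of_mem_erase hw)]
  rw [this, Function.update_self]
  simp only [eq_comm (a := x)]
  omega

theorem ProperOn.update_of_erase {G : SimpleGraph V} {S : Finset V} {c : V → κ} {v : V} {j : κ}
    (hc : ProperOn G (S.erase v) c) (hv : Free G S c v j) :
    ProperOn G S (Function.update c v j) := by
  intro x hx y hy hxy
  by_cases hxv : x = v
  · subst hxv
    rw [Function.update_self, Function.update_of_ne hxy.ne']
    exact (hv y hy hxy).symm
  · by_cases hyv : y = v
    · subst hyv
      rw [Function.update_self, Function.update_of_ne hxv]
      exact hv x hx hxy.symm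
    · rw [Function.update_of_ne hxv, Function.update_of_ne hyv]
      exact hc x (mem_erase.2 ⟨hxv, hx⟩) y (mem_erase.2 ⟨hyv, hy⟩) hxy

theorem ProperOn.update {G : SimpleGraph V} {S : Finset V} {c : V → κ} (hc : ProperOn G S c)
    {v : V} {j : κ} (hv : Free G S c v j) : ProperOn G S (Function.update c v j) :=
  ProperOn.update_of_erase
    (fun x hx y hy => hc x (mem_of_mem_erase hx) y (mem_of_mem_erase hy)) hv

/-- An arc breaks only if its source class loses `v` or its target class gains `v`. The colour `c v`
is not on the path, and all targets lie in `l`, which omits `j`; the head `k` may equal `j`. -/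
theorem isChain_update {G : SimpleGraph V} {S : Finset V} {c : V → κ} {v : V} :
    ∀ (l : List κ) (j k : κ), c v ∉ k :: l → j ∉ l → (k :: l).IsChain (Step G S c) →
      (k :: l).IsChain (Step G S (Function.update c v j))
  | [], _, _, _, _, _ => by simp
  | k' :: l, j, k, hv, hj, h => by
    obtain ⟨⟨w, hw, hwk, hf⟩, h2⟩ := List.isChain_cons_cons.1 h
    simp only [List.mem_cons, not_or] at hv hj
    refine List.isChain_cons_cons.2
      ⟨⟨w, hw, ?_, fun u hu hwu => ?_⟩, isChain_update l j k' ?_ hj.2 h2⟩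
    · rw [Function.update_of_ne]
      · exact hwk
      · rintro rfl
        exact hv.1 hwk
    · by_cases huv : u = v
      · subst huv
        rw [Function.update_self]
        exact hj.1
      · rw [Function.update_of_ne huv]
        exact hf u hu hwu
    · simp only [List.mem_cons, not_or]
      exact hv.2

/-- Shifting one vertex along every edge of a path of colours. -/
theorem exists_shift (G : SimpleGraph V) (S : Finset V) :
    ∀ (l : List κ) (i : κ) (c : V → κ), ProperOn G S c → (i :: l).Nodup →
      (i :: l).IsChain (Step G S c) →
      ∃ c' : V → κ, ProperOn G S c' ∧ (∀ v, c v ∉ i :: l → c' v = c v) ∧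
        (∀ v, c v ∈ i :: l → c' v ∈ i :: l) ∧
        ∀ x, #(cls S c' x) + (if x = i then 1 else 0) =
          #(cls S c x) + if x = (i :: l).getLast (List.cons_ne_nil _ _) then 1 else 0
  | [], i, c, hc, _, _ => ⟨c, hc, fun _ _ => rfl, fun _ h => h, fun x => by simp; congr⟩
  | k :: l, i, c, hc, hnd, hch => by
    obtain ⟨⟨v, hv, hvi, hf⟩, h2⟩ := List.isChain_cons_cons.1 hch
    obtain ⟨hi, hnd2⟩ := List.nodup_cons.1 hnd
    subst hvi
    obtain ⟨c', h1, h3, h4, h5⟩ := exists_shift G S l k (Function.update c v k) (hc.update hf) hnd2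
      (isChain_update l k k hi (List.nodup_cons.1 hnd2).1 h2)
    refine ⟨c', h1, fun u hu => ?_, fun u hu => ?_, fun x => ?_⟩
    · have huv : u ≠ v := by
        rintro rfl
        exact hu (by simp)
      have h : Function.update c v k u = c u := Function.update_of_ne huv _ _
      rw [h3 u, h]
      rw [h]
      exact fun h => hu (List.mem_cons_of_mem _ h)
    · by_cases huv : u = v
      · exact List.mem_cons_of_mem _ (h4 u (by rw [huv, Function.update_self]; simp))
      · have h : Function.update c v k u = c u := Function.update_of_ne huv _ _
        by_cases hu' : c u ∈ k :: l
        · exact List.mem_cons_of_mem _ (h4 u (by rwa [h]))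
        · rw [h3 u (by rwa [h]), h]
          exact hu
    · have e1 := h5 x
      have e2 := card_cls_update c hv k x
      rw [List.getLast_cons_cons]
      omega

/-- Replacing the colours of the vertices of `B'` by those of a colouring `g`. -/
noncomputable def glue (B' : Finset V) (g c : V → κ) : V → κ := fun v => if v ∈ B' then g v else c v

theorem ProperOn.glue {G : SimpleGraph V} {S B' : Finset V} {c g : V → κ} {B : Finset κ}
    (hc : ProperOn G S c) (hg : ProperOn G B' g) (hgB : ∀ v ∈ B', g v ∈ B)
    (h : ∀ v ∈ S, v ∉ B' → c v ∉ B) : ProperOn G S (glue B' g c) := by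
  intro v hv w hw hvw
  unfold EquitableColoring.glue
  split_ifs with h1 h2 h2
  · exact hg v h1 w h2 hvw
  · exact fun e => h w hw h2 (e ▸ hgB v h1)
  · exact fun e => h v hv h1 (e ▸ hgB w h2)
  · exact hc v hv w hw hvw

theorem cls_glue_of_mem {S B' : Finset V} {c g : V → κ} {B : Finset κ} (hB' : B' ⊆ S)
    (h : ∀ v ∈ S, v ∉ B' → c v ∉ B) {x : κ} (hx : x ∈ B) :
    cls S (glue B' g c) x = cls B' g x := by
  ext v
  simp only [mem_cls, glue]
  split_ifs with h1
  · simp [h1, hB' h1]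
  · simp only [h1, false_and, iff_false, not_and]
    exact fun hv e => h v hv h1 (e ▸ hx)

theorem cls_glue_of_notMem {S B' : Finset V} {c g : V → κ} {B : Finset κ}
    (hgB : ∀ v ∈ B', g v ∈ B) (h : ∀ v ∈ B', c v ∈ B) {x : κ} (hx : x ∉ B) :
    cls S (glue B' g c) x = cls S c x := by
  ext v
  simp only [mem_cls, glue]
  split_ifs with h1
  · exact and_congr_right fun _ => ⟨fun e => absurd (e ▸ hgB v h1) hx,
      fun e => absurd (e ▸ h v h1) hx⟩
  · rfl

/-! ### Degree counting and discharging -/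

/-- The number of neighbours of `v` of colour `i`. -/
noncomputable def colDeg (G : SimpleGraph V) (S : Finset V) (c : V → κ) (v : V) (i : κ) : ℕ :=
  #(S.filter fun w => G.Adj v w ∧ c w = i)

/-- The number of neighbours of `v` whose colour is not in `A`. -/
noncomputable def outDeg (G : SimpleGraph V) (S : Finset V) (c : V → κ) (A : Finset κ) (v : V) :
    ℕ := #(S.filter fun w => G.Adj v w ∧ c w ∉ A)

theorem sum_colDeg_add_outDeg (G : SimpleGraph V) (S : Finset V) (c : V → κ) (A : Finset κ)
    (v : V) : ∑ i ∈ A, colDeg G S c v i + outDeg G S c A v = #(S.filter (G.Adj v)) := by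
  rw [← card_filter_add_card_filter_not (s := S.filter (G.Adj v)) (fun w => c w ∈ A)]
  simp only [filter_filter]
  unfold outDeg
  congr 1
  rw [card_eq_sum_card_fiberwise (f := c) (t := A) (fun w hw => by
    simp only [coe_filter, Set.mem_ofPred_eq] at hw
    exact hw.2.2)]
  refine sum_congr rfl fun i hi => ?_
  unfold colDeg
  congr 1
  ext w
  simp only [mem_filter]
  constructor
  · rintro ⟨h1, h2, rfl⟩
    exact ⟨⟨h1, h2, hi⟩, rfl⟩
  · rintro ⟨⟨h1, h2, -⟩, h3⟩
    exact ⟨h1, h2, h3⟩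

theorem colDeg_pos {G : SimpleGraph V} {S : Finset V} {c : V → κ} {v : V} {i : κ}
    (h : ¬ Free G S c v i) : 0 < colDeg G S c v i := by
  unfold Free at h
  push Not at h
  obtain ⟨w, hw, h1, h2⟩ := h
  exact card_pos.2 ⟨w, mem_filter.2 ⟨hw, h1, h2⟩⟩

theorem card_le_sum_colDeg {G : SimpleGraph V} {S : Finset V} {c : V → κ} {v : V} {A A' : Finset κ}
    (hA' : A' ⊆ A) (h : ∀ i ∈ A', ¬ Free G S c v i) : #A' ≤ ∑ i ∈ A, colDeg G S c v i := by
  calc #A' = ∑ i ∈ A', 1 := by simp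
    _ ≤ ∑ i ∈ A', colDeg G S c v i := sum_le_sum fun i hi => colDeg_pos (h i hi)
    _ ≤ _ := sum_le_sum_of_subset hA'

/-- `y` has a colour outside `A`, and `z` is the only neighbour of `y` having the colour of `z`. -/
def Special (G : SimpleGraph V) (S : Finset V) (c : V → κ) (A : Finset κ) (z y : V) : Prop :=
  y ∈ S ∧ c y ∉ A ∧ G.Adj y z ∧ ∀ w ∈ S, G.Adj y w → c w = c z → w = z

section Counting

variable {G : SimpleGraph V} {S : Finset V} {c : V → κ} {A T : Finset κ} {U : κ} {q s : ℕ}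

theorem outDeg_lt (hdeg : ∀ v ∈ S, #(S.filter (G.Adj v)) < #A + q)
    (hB : ∀ y ∈ S, c y ∉ A → ∀ i ∈ A, ¬ Free G S c y i) {y : V} (hy : y ∈ S) (hyA : c y ∉ A) :
    outDeg G S c A y < q := by
  have h1 := hdeg y hy
  rw [← sum_colDeg_add_outDeg G S c A y] at h1
  have h2 := card_le_sum_colDeg (subset_refl A) (hB y hy hyA)
  omega

/-- Of at most `#A + q - 1` neighbours of `x`, at least one lies in each of the `#A - #T - 1`
classes of `A` outside `T` and `U`. -/
theorem outDeg_le_add (hdeg : ∀ v ∈ S, #(S.filter (G.Adj v)) < #A + q) (hT : T ⊆ A) (hU : U ∈ A)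
    (hUT : U ∉ T) (hTU : ∀ x ∈ S, c x ∈ T → ∀ i ∈ A, i ∉ T → i ≠ U → ¬ Free G S c x i)
    {x : V} (hx : x ∈ S) (hxT : c x ∈ T) : outDeg G S c A x ≤ q + #T := by
  have h1 := hdeg x hx
  rw [← sum_colDeg_add_outDeg G S c A x] at h1
  have h2 : #((A \ T).erase U) ≤ ∑ i ∈ A, colDeg G S c x i :=
    card_le_sum_colDeg ((erase_subset _ _).trans sdiff_subset) fun i hi => by
      simp only [mem_erase, mem_sdiff] at hi
      exact hTU x hx hxT i hi.2.1 hi.2.2 hi.1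
  rw [card_erase_of_mem (mem_sdiff.2 ⟨hU, hUT⟩), card_sdiff_of_subset hT] at h2
  have h3 := card_lt_card ((ssubset_iff_of_subset hT).2 ⟨U, hU, hUT⟩)
  omega

theorem outDeg_le_of_not_free (hdeg : ∀ v ∈ S, #(S.filter (G.Adj v)) < #A + q) {z : V} (hz : z ∈ S)
    (hzA : c z ∈ A) (hf : ∀ X ∈ A, X ≠ c z → ¬ Free G S c z X) : outDeg G S c A z ≤ q := by
  have h1 := hdeg z hz
  rw [← sum_colDeg_add_outDeg G S c A z] at h1
  have h2 : #(A.erase (c z)) ≤ ∑ i ∈ A, colDeg G S c z i :=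
    card_le_sum_colDeg (erase_subset _ _) fun i hi => hf i (mem_of_mem_erase hi) (ne_of_mem_erase hi)
  rw [card_erase_of_mem hzA] at h2
  have := card_pos.2 ⟨_, hzA⟩
  omega

/-- Each class of `A` uses one neighbour of `y`, and each class of `T` without a unique neighbour
uses another. The degree bound leaves at most `q - 1 - outDeg` such classes; every other class of
`T` supplies a special `z`. -/
theorem le_card_special (hdeg : ∀ v ∈ S, #(S.filter (G.Adj v)) < #A + q) (hT : T ⊆ A)
    (hB : ∀ y ∈ S, c y ∉ A → ∀ i ∈ A, ¬ Free G S c y i) {y : V} (hy : y ∈ S) (hyA : c y ∉ A) :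
    #T + 1 + outDeg G S c A y ≤ #(S.filter fun z => c z ∈ T ∧ Special G S c A z y) + q := by
  have h1 := hdeg y hy
  rw [← sum_colDeg_add_outDeg G S c A y] at h1
  have h2 : #A + #(T.filter fun i => colDeg G S c y i ≠ 1) ≤ ∑ i ∈ A, colDeg G S c y i := by
    calc #A + #(T.filter fun i => colDeg G S c y i ≠ 1)
        ≤ #A + #(A.filter fun i => colDeg G S c y i ≠ 1) := by
          gcongr
      _ = ∑ i ∈ A, (1 + if colDeg G S c y i ≠ 1 then 1 else 0) := by
          rw [sum_add_distrib, card_filter]; simp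
      _ ≤ _ := sum_le_sum fun i hi => by
          have := colDeg_pos (hB y hy hyA i hi)
          split_ifs <;> omega
  have h3 : #(T.filter fun i => colDeg G S c y i = 1) ≤
      #(S.filter fun z => c z ∈ T ∧ Special G S c A z y) := by
    refine (card_le_card (t := (S.filter fun z => c z ∈ T ∧ Special G S c A z y).image c)
      fun i hi => ?_).trans card_image_le
    obtain ⟨hiT, hi1⟩ := mem_filter.1 hi
    obtain ⟨z, hz⟩ := card_eq_one.1 hi1
    have hz' : ∀ w, (w ∈ S ∧ G.Adj y w ∧ c w = i) ↔ w = z := fun w => by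
      rw [← mem_filter (p := fun w => G.Adj y w ∧ c w = i), hz, mem_singleton]
    obtain ⟨hzS, hyz, hzi⟩ := (hz' z).2 rfl
    subst hzi
    exact mem_image.2 ⟨z, mem_filter.2 ⟨hzS, hiT, hy, hyA, hyz,
      fun w hw hyw hcw => (hz' w).1 ⟨hw, hyw, hcw⟩⟩, rfl⟩
  have h4 := card_filter_add_card_filter_not (s := T) (fun i => colDeg G S c y i = 1)
  simp only [ne_eq] at h2
  omega

theorem sum_outDeg (G : SimpleGraph V) (S : Finset V) (c : V → κ) (A : Finset κ) (W : κ)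
    (w : V → ℕ) :
    ∑ x ∈ cls S c W, w x * outDeg G S c A x =
      ∑ y ∈ S.filter (fun y => c y ∉ A), ∑ x ∈ (cls S c W).filter (G.Adj y), w x := by
  have h : ∀ y, (if c y ∉ A then ∑ x ∈ cls S c W, if G.Adj y x then w x else 0 else 0) =
      ∑ x ∈ cls S c W, if G.Adj x y ∧ c y ∉ A then w x else 0 := fun y => by
    split_ifs with h <;> simp [h, G.adj_comm y]
  simp only [sum_filter, h]
  rw [sum_comm]
  refine sum_congr rfl fun x _ => ?_
  rw [← sum_filter, sum_const, smul_eq_mul, mul_comm, outDeg]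

/-- Suppose `#T ≤ q`, and give the vertices of class `W` weight 2 if they are special for some `y`,
else 1. Every `y` outside `A` sees weight at least 2 in `W`: a special neighbour or two neighbours.
Each `x` in `W` contributes at most `2 * q`, so at most `q * s` vertices lie outside `A`, a
contradiction. -/
theorem lt_card_of_solo_not_free (hdeg : ∀ v ∈ S, #(S.filter (G.Adj v)) < #A + q) (hT : T ⊆ A)
    (hU : U ∈ A) (hUT : U ∉ T)
    (hB : ∀ y ∈ S, c y ∉ A → ∀ i ∈ A, ¬ Free G S c y i)
    (hTU : ∀ x ∈ S, c x ∈ T → ∀ i ∈ A, i ∉ T → i ≠ U → ¬ Free G S c x i)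
    (hBc : q * s < #(S.filter fun y => c y ∉ A)) {W : κ} (hW : W ∈ T) (hWs : #(cls S c W) = s)
    (hf : ∀ z ∈ cls S c W, (∃ y, Special G S c A z y) → ∀ X ∈ A, X ≠ c z → ¬ Free G S c z X) :
    q < #T := by
  by_contra! hle
  let w : V → ℕ := fun z => if ∃ y, Special G S c A z y then 2 else 1
  have hw : ∀ z, 1 ≤ w z := fun z => by
    simp only [w]; split_ifs <;> omega
  have e := sum_outDeg G S c A W w
  have h1 : ∑ x ∈ cls S c W, w x * outDeg G S c A x ≤ ∑ x ∈ cls S c W, 2 * q := by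
    refine sum_le_sum fun x hx => ?_
    obtain ⟨hxS, hxW⟩ := mem_cls.1 hx
    by_cases hsolo : ∃ y, Special G S c A x y
    · have := outDeg_le_of_not_free hdeg hxS (hT (hxW ▸ hW)) (hf x hx hsolo)
      simp only [w, if_pos hsolo]
      omega
    · have := outDeg_le_add hdeg hT hU hUT hTU hxS (hxW ▸ hW)
      simp only [w, if_neg hsolo]
      omega
  have h2 : ∑ y ∈ S.filter (fun y => c y ∉ A), 2 ≤
      ∑ y ∈ S.filter (fun y => c y ∉ A), ∑ x ∈ (cls S c W).filter (G.Adj y), w x := by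
    refine sum_le_sum fun y hy => ?_
    obtain ⟨hyS, hyA⟩ := mem_filter.1 hy
    have := hB y hyS hyA W (hT hW)
    unfold Free at this
    push Not at this
    obtain ⟨z, hz, hyz, hzW⟩ := this
    have hzm : z ∈ (cls S c W).filter (G.Adj y) := mem_filter.2 ⟨mem_cls.2 ⟨hz, hzW⟩, hyz⟩
    by_cases hsp : Special G S c A z y
    · refine le_trans ?_ (single_le_sum (fun _ _ => Nat.zero_le _) hzm)
      simp only [w, if_pos (⟨y, hsp⟩ : ∃ y, Special G S c A z y)]
      exact le_rfl
    · have : ∃ u ∈ S, G.Adj y u ∧ c u = c z ∧ u ≠ z := by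
        by_contra! h
        exact hsp ⟨hyS, hyA, hyz, h⟩
      obtain ⟨u, hu, hyu, huz, hne⟩ := this
      have hum : u ∈ (cls S c W).filter (G.Adj y) :=
        mem_filter.2 ⟨mem_cls.2 ⟨hu, huz.trans hzW⟩, hyu⟩
      calc 2 = #{u, z} := (card_pair hne).symm
        _ ≤ #((cls S c W).filter (G.Adj y)) := card_le_card (by
            intro a ha
            rcases mem_insert.1 ha with rfl | ha
            · exact hum
            · exact mem_singleton.1 ha ▸ hzm)
        _ = ∑ x ∈ (cls S c W).filter (G.Adj y), 1 := by simp
        _ ≤ _ := sum_le_sum fun x _ => hw x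
  simp only [sum_const, smul_eq_mul, hWs] at h1 h2
  nlinarith

/-- Otherwise no special `z` can move within `A`, and the vertices `y` for which `z` is special form
a clique. Each `z` coloured in `T` shares charge `q` equally among these `y`. Every `y` outside `A`
then receives at least `#T`, while the total is at most `#T * s * q`, which is too little. -/
theorem exists_solo (hdeg : ∀ v ∈ S, #(S.filter (G.Adj v)) < #A + q) (hT : T ⊆ A)
    (hTne : T.Nonempty) (hU : U ∈ A) (hUT : U ∉ T)
    (hB : ∀ y ∈ S, c y ∉ A → ∀ i ∈ A, ¬ Free G S c y i)
    (hTU : ∀ x ∈ S, c x ∈ T → ∀ i ∈ A, i ∉ T → i ≠ U → ¬ Free G S c x i)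
    (hBc : q * s < #(S.filter fun y => c y ∉ A)) (hs : ∀ W ∈ T, #(cls S c W) = s) :
    ∃ z ∈ S, c z ∈ T ∧ ∃ y, Special G S c A z y ∧
      ((∃ X ∈ A, X ≠ c z ∧ Free G S c z X) ∨
        ((∀ X ∈ A, X ≠ c z → ¬ Free G S c z X) ∧
          ∃ y', Special G S c A z y' ∧ y' ≠ y ∧ ¬ G.Adj y y')) := by
  by_contra! hcon
  have hnf : ∀ z ∈ S, c z ∈ T → (∃ y, Special G S c A z y) →
      ∀ X ∈ A, X ≠ c z → ¬ Free G S c z X := fun z hz hzT ⟨y, hy⟩ => (hcon z hz hzT y hy).1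
  have hcl : ∀ z ∈ S, c z ∈ T → ∀ y, Special G S c A z y → ∀ y', Special G S c A z y' → y' ≠ y →
      G.Adj y y' := fun z hz hzT y hy => (hcon z hz hzT y hy).2 (hnf z hz hzT ⟨y, hy⟩)
  obtain ⟨W, hW⟩ := hTne
  have hqT : q < #T := lt_card_of_solo_not_free hdeg hT hU hUT hB hTU hBc hW (hs W hW)
    fun z hz => hnf z (mem_cls.1 hz).1 ((mem_cls.1 hz).2 ▸ hW)
  let B := S.filter fun y => c y ∉ A
  let A' := S.filter fun z => c z ∈ T
  let d : V → ℕ := fun z => #(B.filter fun y => Special G S c A z y)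
  let μ : V → V → ℚ := fun z y => if Special G S c A z y then (q : ℚ) / d z else 0
  have hA' : #A' = #T * s := by
    rw [card_eq_sum_card_fiberwise (f := c) (t := T) (fun w hw => by
      simp only [A', coe_filter, Set.mem_ofPred_eq] at hw
      exact hw.2), sum_const_nat]
    intro W hW
    rw [← hs W hW]
    congr 1
    ext v
    simp only [A', mem_filter, mem_cls]
    constructor
    · rintro ⟨⟨h1, -⟩, h2⟩
      exact ⟨h1, h2⟩
    · rintro ⟨h1, rfl⟩
      exact ⟨⟨h1, hW⟩, rfl⟩
  have hz : ∀ z ∈ A', ∑ y ∈ B, μ z y ≤ q := by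
    intro z _
    simp only [μ]
    rw [← sum_filter, sum_const, nsmul_eq_mul]
    rcases (d z).eq_zero_or_pos with h | h
    · simp only [d] at h
      simp [h]
    · exact (mul_div_cancel₀ _ (by exact_mod_cast h.ne')).le
  have hy : ∀ y ∈ B, (#T : ℚ) ≤ ∑ z ∈ A', μ z y := by
    intro y hy
    obtain ⟨hyS, hyA⟩ := mem_filter.1 hy
    have h1 := le_card_special hdeg hT hB hyS hyA
    have h2 := outDeg_lt hdeg hB hyS hyA
    simp only [μ]
    rw [← sum_filter]
    set e := outDeg G S c A y
    have h3 : ∀ z ∈ A'.filter (fun z => Special G S c A z y), (q : ℚ) / (e + 1 : ℕ) ≤ q / d z := by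
      intro z hz
      obtain ⟨hzA', hsp⟩ := mem_filter.1 hz
      obtain ⟨hzS, hzT⟩ := mem_filter.1 hzA'
      have hpos : 0 < d z := card_pos.2 ⟨y, mem_filter.2 ⟨hy, hsp⟩⟩
      -- By the clique property, all other vertices sharing `z` are neighbours of `y` outside `A`.
      have hle : d z ≤ e + 1 := by
        have : (B.filter fun y => Special G S c A z y).erase y ⊆
            S.filter fun w => G.Adj y w ∧ c w ∉ A := by
          intro w hw
          obtain ⟨hwy, hw⟩ := mem_erase.1 hw
          have hsw := (mem_filter.1 hw).2
          exact mem_filter.2 ⟨hsw.1, hcl z hzS hzT y hsp w hsw hwy, hsw.2.1⟩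
        have := card_le_card this
        rw [card_erase_of_mem (mem_filter.2 ⟨hy, hsp⟩)] at this
        exact Nat.sub_le_iff_le_add.1 this
      exact div_le_div_of_nonneg_left (Nat.cast_nonneg _) (by exact_mod_cast hpos)
        (by exact_mod_cast hle)
    refine le_trans ?_ (card_nsmul_le_sum _ _ _ h3)
    have hset : A'.filter (fun z => Special G S c A z y) =
        S.filter fun z => c z ∈ T ∧ Special G S c A z y := by
      simp only [A', filter_filter]
    rw [hset, nsmul_eq_mul, ← mul_div_assoc, le_div_iff₀ (by positivity)]
    -- With `#T = q + u + 1` and `q = e + p + 1`, `(u + 2 + e) * q` exceeds the left side by `(u +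
    -- 1) * p`.
    have h4 : #T * (e + 1) ≤ #(S.filter fun z => c z ∈ T ∧ Special G S c A z y) * q := by
      obtain ⟨u, hu⟩ := Nat.exists_eq_add_of_lt hqT
      obtain ⟨p, hp⟩ := Nat.exists_eq_add_of_lt h2
      have h5 : u + 1 + 1 + e ≤ #(S.filter fun z => c z ∈ T ∧ Special G S c A z y) := by omega
      refine le_trans ?_ (Nat.mul_le_mul_right q h5)
      rw [hu, hp]
      nlinarith
    exact_mod_cast h4
  have h1 : ∑ z ∈ A', ∑ y ∈ B, μ z y ≤ #A' * q := by
    have := sum_le_card_nsmul _ _ _ hz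
    rwa [nsmul_eq_mul] at this
  have h2 : (#B : ℚ) * #T ≤ ∑ y ∈ B, ∑ z ∈ A', μ z y := by
    have := card_nsmul_le_sum _ _ _ hy
    rwa [nsmul_eq_mul] at this
  rw [sum_comm] at h1
  have h3 : #B * #T ≤ #A' * q := by exact_mod_cast h2.trans h1
  rw [hA'] at h3
  have h4 : q * s < #B := hBc
  nlinarith

end Counting

/-- The colouring `c` of `S` is proper, uses colours from `C`, and uses each of them `s` times. -/
def IsEquitable (G : SimpleGraph V) (S : Finset V) (C : Finset κ) (s : ℕ) (c : V → κ) : Prop :=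
  (∀ v ∈ S, c v ∈ C) ∧ ProperOn G S c ∧ ∀ i ∈ C, #(cls S c i) = s

/-- The relation `Step` between colours of `C`. -/
def Mov (G : SimpleGraph V) (S : Finset V) (C : Finset κ) (c : V → κ) (i j : κ) : Prop :=
  i ∈ C ∧ j ∈ C ∧ Step G S c i j

/-- The colours from which `a` can be reached. -/
noncomputable def acc (G : SimpleGraph V) (S : Finset V) (C : Finset κ) (c : V → κ) (a : κ) :
    Finset κ := C.filter fun i => ReflTransGen (Mov G S C c) i a

/-! ### Nearly equitable colourings -/

section Near

variable {G : SimpleGraph V} {S : Finset V} {C : Finset κ} {s : ℕ} {c : V → κ} {a b : κ}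

theorem mem_acc (ha : a ∈ C) {i : κ} : i ∈ acc G S C c a ↔ ReflTransGen (Mov G S C c) i a := by
  unfold acc
  rw [mem_filter, and_iff_right_iff_imp]
  intro h
  rcases ReflTransGen.cases_head h with rfl | ⟨_, h, _⟩
  · exact ha
  · exact h.1

theorem ReflTransGen.of_avoid {r : κ → κ → Prop} {U x y : κ} (h : ReflTransGen (Avoid r U) x y) :
    ReflTransGen r x y := by
  induction h with
  | refl => exact .refl
  | tail _ h ih => exact ih.tail h.1

theorem card_filter_notMem_acc (hc : ∀ v ∈ S, c v ∈ C)
    (hs : ∀ i ∈ C, #(cls S c i) + (if i = a then 1 else 0) = s + if i = b then 1 else 0)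
    {A : Finset κ} (ha : a ∈ A) (hb : b ∈ C) (hbA : b ∉ A) :
    #(S.filter fun v => c v ∉ A) = #(C \ A) * s + 1 := by
  rw [card_eq_sum_card_fiberwise (f := c) (t := C \ A) (fun w hw => by
      simp only [coe_filter, Set.mem_ofPred_eq] at hw
      exact mem_coe.2 (mem_sdiff.2 ⟨hc w hw.1, hw.2⟩))]
  have h : ∀ i ∈ C \ A, #((S.filter fun v => c v ∉ A).filter fun v => c v = i) =
      s + if i = b then 1 else 0 := by
    intro i hi
    obtain ⟨hiC, hiA⟩ := mem_sdiff.1 hi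
    have hia : i ≠ a := fun h => hiA (h ▸ ha)
    rw [← hs i hiC, if_neg hia, add_zero, filter_filter]
    congr 1
    ext v
    simp only [mem_filter, mem_cls]
    exact and_congr_right fun _ => ⟨fun h => h.2, fun h => ⟨h ▸ hiA, h⟩⟩
  rw [sum_congr rfl h, sum_add_distrib, sum_const, smul_eq_mul, sum_ite_eq' (C \ A) b,
    if_pos (mem_sdiff.2 ⟨hb, hbA⟩)]

/-- If `A = {a}`, the `s - 1` vertices of class `a` have at most `#(C \ A)` neighbours each outside
`A`, too few to meet all `#(C \ A) * s + 1` vertices there. -/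
theorem exists_acc_ne (hdeg : ∀ v ∈ S, #(S.filter (G.Adj v)) < #C) (hc : ∀ v ∈ S, c v ∈ C)
    (hs : ∀ i ∈ C, #(cls S c i) + (if i = a then 1 else 0) = s + if i = b then 1 else 0)
    {A : Finset κ} (hAC : A ⊆ C) (ha : a ∈ A) (hb : b ∈ C) (hbA : b ∉ A)
    (hB : ∀ y ∈ S, c y ∉ A → ∀ i ∈ A, ¬ Free G S c y i) : ∃ x ∈ A, x ≠ a := by
  by_contra! h
  have hA : A = {a} := eq_singleton_iff_unique_mem.2 ⟨ha, h⟩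
  have hB' := card_filter_notMem_acc hc hs ha hb hbA
  have hC : #C = 1 + #(C \ A) := by
    have := card_sdiff_add_card_eq_card hAC
    rw [hA, card_singleton] at this
    rw [hA]
    omega
  have e := sum_outDeg G S c A a (fun _ => 1)
  have h1 : ∑ x ∈ cls S c a, 1 * outDeg G S c A x ≤ ∑ x ∈ cls S c a, #(C \ A) := by
    refine sum_le_sum fun x hx => ?_
    have h1 := hdeg x (mem_cls.1 hx).1
    rw [← sum_colDeg_add_outDeg G S c A x] at h1
    omega
  have h2 : ∑ y ∈ S.filter (fun y => c y ∉ A), 1 ≤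
      ∑ y ∈ S.filter (fun y => c y ∉ A), ∑ x ∈ (cls S c a).filter (G.Adj y), 1 := by
    refine sum_le_sum fun y hy => ?_
    obtain ⟨hyS, hyA⟩ := mem_filter.1 hy
    have := hB y hyS hyA a ha
    unfold Free at this
    push Not at this
    obtain ⟨z, hz, hyz, hza⟩ := this
    rw [← card_eq_sum_ones]
    exact card_pos.2 ⟨z, mem_filter.2 ⟨mem_cls.2 ⟨hz, hza⟩, hyz⟩⟩
  have h3 := hs a (hAC ha)
  have hab : a ≠ b := fun h => hbA (h ▸ ha)
  simp only [if_neg hab, if_true] at h3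
  rw [sum_const, smul_eq_mul] at h1 h2
  have h4 : #(cls S c a) * #(C \ A) ≤ #(C \ A) * s := by
    rw [mul_comm]
    exact Nat.mul_le_mul_left _ (by omega)
  omega

theorem exists_isEquitable_of_mem_acc (hc : ∀ v ∈ S, c v ∈ C) (hp : ProperOn G S c)
    (ha : a ∈ C) (hb : b ∈ acc G S C c a)
    (hs : ∀ i ∈ C, #(cls S c i) + (if i = a then 1 else 0) = s + if i = b then 1 else 0) :
    ∃ c' : V → κ, IsEquitable G S C s c' := by
  obtain ⟨l, hnd, hch, hl⟩ := exists_nodup_chain ((mem_acc ha).1 hb)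
  obtain ⟨c', h1, h2, h3, h4⟩ := exists_shift G S l b c hp hnd (hch.imp fun _ _ h => h.2.2)
  refine ⟨c', fun v hv => ?_, h1, fun i hi => ?_⟩
  · by_cases h : c v ∈ b :: l
    · rcases List.mem_cons.1 (h3 v h) with h' | h'
      · exact h' ▸ (mem_filter.1 hb).1
      · exact isChain_tail_forall (P := fun x => x ∈ C) (fun _ _ h => h.2.1) l b hch _ h'
    · rw [h2 v h]
      exact hc v hv
  · have e1 := h4 i
    have e2 := hs i hi
    rw [hl] at e1
    omega

/-- Move `z` to `X`, shift along a path from `X` to `a` avoiding `c z`, and let `y` take the colour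
`c z`, where `z` was its only neighbour. All classes of `A` then have size `s`, and `g` recolours
the remaining vertices. -/
theorem exists_isEquitable_of_swap (hc : ∀ v ∈ S, c v ∈ C) (hp : ProperOn G S c)
    (hs : ∀ i ∈ C, #(cls S c i) + (if i = a then 1 else 0) = s + if i = b then 1 else 0)
    {A : Finset κ} (hAC : A ⊆ C) (hbA : b ∉ A) (hA : ∀ x y, Mov G S C c x y → y ∈ A → x ∈ A)
    (ha : a ∈ A) {z y : V} {X : κ} (hz : z ∈ S) (hzA : c z ∈ A) (hsp : Special G S c A z y)
    (hXz : X ≠ c z) (hf : Free G S c z X)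
    (hr : ReflTransGen (Avoid (Mov G S C c) (c z)) X a) {g : V → κ}
    (hg : IsEquitable G ((S.filter fun v => c v ∉ A).erase y) (C \ A) s g) :
    ∃ c' : V → κ, IsEquitable G S C s c' := by
  obtain ⟨hyS, hyA, hyz, hyu⟩ := hsp
  obtain ⟨l, hnd, hch, hl⟩ := exists_nodup_chain hr
  have hzl : c z ∉ X :: l := by
    rintro h
    rcases List.mem_cons.1 h with h | h
    · exact hXz h.symm
    · exact isChain_tail_forall (P := fun x => x ≠ c z) (fun _ _ h => h.2.2) l X hch _ h rfl
  have hch' : (X :: l).IsChain (Step G S c) := hch.imp fun _ _ h => h.1.2.2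
  have hlA : ∀ x ∈ X :: l, x ∈ A := by
    have key : ∀ (l : List κ) (X : κ), (X :: l).IsChain (Avoid (Mov G S C c) (c z)) →
        (X :: l).getLast (List.cons_ne_nil _ _) ∈ A → ∀ x ∈ X :: l, x ∈ A := by
      intro l
      induction l with
      | nil => simp
      | cons k l ih =>
        intro X hch hl
        obtain ⟨h1, h2⟩ := List.isChain_cons_cons.1 hch
        rw [List.getLast_cons_cons] at hl
        have := ih k h2 hl
        intro x hx
        rcases List.mem_cons.1 hx with rfl | hx
        · exact hA _ _ h1.1 (this k (by simp))
        · exact this x hx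
    exact key l X hch (hl ▸ ha)
  have hc1z : Function.update c z X z = X := Function.update_self _ _ _
  have hc1 : ∀ v, v ≠ z → Function.update c z X v = c v := fun v hv => Function.update_of_ne hv _ _
  obtain ⟨c', h1, h2, h3, h4⟩ := exists_shift G S l X (Function.update c z X) (hp.update hf) hnd
    (isChain_update l X X hzl (List.nodup_cons.1 hnd).1 hch')
  have hc'A : ∀ v, c v ∈ A → c' v ∈ A := by
    intro v hv
    by_cases h : Function.update c z X v ∈ X :: l
    · exact hlA _ (h3 v h)
    · have hvz : v ≠ z := by
        rintro rfl
        exact h (by rw [hc1z]; simp)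
      rw [h2 v h, hc1 v hvz]
      exact hv
  have hc'B : ∀ v, c v ∉ A → c' v = c v := by
    intro v hv
    have hvz : v ≠ z := by
      rintro rfl
      exact hv hzA
    have := hc1 v hvz
    rw [h2 v, this]
    rw [this]
    exact fun h => hv (hlA _ h)
  have hfree : Free G S c' y (c z) := by
    intro w hw hyw hwz
    have h : Function.update c z X w ∉ X :: l := fun h => hzl (hwz ▸ h3 w h)
    have hne : w ≠ z := by
      rintro rfl
      exact h (by rw [hc1z]; simp)
    rw [h2 w h, hc1 w hne] at hwz
    exact hne (hyu w hw hyw hwz)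
  set d := Function.update c' y (c z) with hd
  set B' := (S.filter fun v => c v ∉ A).erase y with hB'
  have hdB : ∀ v ∈ B', d v ∈ C \ A := by
    intro v hv
    obtain ⟨hvy, hv⟩ := mem_erase.1 hv
    obtain ⟨hvS, hvA⟩ := mem_filter.1 hv
    rw [hd, Function.update_of_ne hvy, hc'B v hvA]
    exact mem_sdiff.2 ⟨hc v hvS, hvA⟩
  have hdA : ∀ v ∈ S, v ∉ B' → d v ∈ A := by
    intro v hvS hv
    by_cases hvy : v = y
    · rw [hd, hvy, Function.update_self]
      exact hzA
    · rw [hd, Function.update_of_ne hvy]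
      refine hc'A v ?_
      by_contra h
      exact hv (mem_erase.2 ⟨hvy, mem_filter.2 ⟨hvS, h⟩⟩)
  have hdA' : ∀ v ∈ S, v ∉ B' → d v ∉ C \ A := fun v hv hv' h =>
    (mem_sdiff.1 h).2 (hdA v hv hv')
  have hB'S : B' ⊆ S := (erase_subset _ _).trans (filter_subset _ _)
  refine ⟨glue B' g d, fun v hv => ?_, (h1.update hfree).glue hg.2.1 hg.1 hdA', fun x hx => ?_⟩
  · unfold glue
    split_ifs with h
    · exact (mem_sdiff.1 (hg.1 v h)).1
    · exact hAC (hdA v hv h)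
  · by_cases hxA : x ∈ A
    · rw [cls_glue_of_notMem hg.1 hdB (fun h => (mem_sdiff.1 h).2 hxA)]
      have e1 := card_cls_update c' hyS (c z) x
      have e2 := h4 x
      have e3 := card_cls_update c hz X x
      have e4 := hs x hx
      have hxb : x ≠ b := fun h => hbA (h ▸ hxA)
      have hxy : x ≠ c' y := fun h => hyA (by rwa [← hc'B y hyA, ← h])
      rw [hl] at e2
      rw [if_neg hxy] at e1
      rw [if_neg hxb] at e4
      rw [← hd] at e1
      omega
    · rw [cls_glue_of_mem hB'S hdA' (mem_sdiff.2 ⟨hx, hxA⟩)]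
      exact hg.2.2 x (mem_sdiff.2 ⟨hx, hxA⟩)

/-- Let `y` take the colour of `z`, recolour the rest outside `A` by `g`, and move `z` to a class
outside `A`, which becomes the oversized one. All colours of `A` still reach `a`, and the new colour
of `y'` joins them. -/
theorem exists_near_of_not_free (hdeg : ∀ v ∈ S, #(S.filter (G.Adj v)) < #C)
    (hc : ∀ v ∈ S, c v ∈ C) (hp : ProperOn G S c) (ha : a ∈ C)
    (hs : ∀ i ∈ C, #(cls S c i) + (if i = a then 1 else 0) = s + if i = b then 1 else 0)
    (hbA : b ∉ acc G S C c a) {z y y' : V} (hz : z ∈ S) (hzA : c z ∈ acc G S C c a) (hza : c z ≠ a)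
    (hsp : Special G S c (acc G S C c a) z y) (hsp' : Special G S c (acc G S C c a) z y')
    (hyy : y' ≠ y) (hadj : ¬ G.Adj y y')
    (hf : ∀ X ∈ acc G S C c a, X ≠ c z → ¬ Free G S c z X)
    (hr : ∀ x ∈ acc G S C c a, x ≠ c z → ReflTransGen (Avoid (Mov G S C c) (c z)) x a) {g : V → κ}
    (hg : IsEquitable G ((S.filter fun v => c v ∉ acc G S C c a).erase y)
      (C \ acc G S C c a) s g) :
    ∃ (c' : V → κ) (b' : κ), b' ∈ C ∧ (∀ v ∈ S, c' v ∈ C) ∧ ProperOn G S c' ∧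
      (∀ i ∈ C, #(cls S c' i) + (if i = a then 1 else 0) = s + if i = b' then 1 else 0) ∧
      #(C \ acc G S C c' a) < #(C \ acc G S C c a) := by
  set A := acc G S C c a with hAdef
  have hAC : A ⊆ C := filter_subset _ _
  have hCA : #C = #A + #(C \ A) := by
    have := card_sdiff_add_card_eq_card hAC
    omega
  obtain ⟨hyS, hyA, hyz, hyu⟩ := hsp
  obtain ⟨hyS', hyA', hyz', hyu'⟩ := hsp'
  set B' := (S.filter fun v => c v ∉ A).erase y with hB'
  have hB'S : B' ⊆ S := (erase_subset _ _).trans (filter_subset _ _)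
  have hB'A : ∀ v ∈ B', c v ∉ A := fun v hv => (mem_filter.1 (mem_of_mem_erase hv)).2
  have hzB' : z ∉ B' := fun h => hB'A z h hzA
  have hzy : z ≠ y := fun h => hyA (h ▸ hzA)
  have hyB' : y ∉ B' := notMem_erase _ _
  have hy'B' : y' ∈ B' := mem_erase.2 ⟨hyy, mem_filter.2 ⟨hyS', hyA'⟩⟩
  -- `z` has at most `#(C \ A)` neighbours outside `A`, one of them `y`, so some colour of `C \ A`
  -- is missed by the others.
  obtain ⟨Y, hY, hYf⟩ : ∃ Y ∈ C \ A, ∀ w ∈ B', G.Adj z w → g w ≠ Y := by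
    have h1 := outDeg_le_of_not_free (by rwa [← hCA]) hz hzA hf
    have h2 : #((B'.filter (G.Adj z)).image g) < #(C \ A) := by
      refine card_image_le.trans_lt (lt_of_lt_of_le (card_lt_card ?_) h1)
      refine (ssubset_iff_of_subset fun w hw => ?_).2
        ⟨y, mem_filter.2 ⟨hyS, hyz.symm, hyA⟩, fun h => hyB' (mem_filter.1 h).1⟩
      obtain ⟨hw1, hw2⟩ := mem_filter.1 hw
      exact mem_filter.2 ⟨hB'S hw1, hw2, hB'A w hw1⟩
    obtain ⟨Y, hY, hY'⟩ := exists_mem_notMem_of_card_lt_card h2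
    exact ⟨Y, hY, fun w hw hzw h => hY' (mem_image.2 ⟨w, mem_filter.2 ⟨hw, hzw⟩, h⟩)⟩
  have hYA : Y ∉ A := (mem_sdiff.1 hY).2
  have hgA : ∀ v ∈ B', g v ∉ A := fun v hv => (mem_sdiff.1 (hg.1 v hv)).2
  set d := Function.update c y (c z) with hd
  have hdy : d y = c z := Function.update_self _ _ _
  have hdc : ∀ v, v ≠ y → d v = c v := fun v hv => Function.update_of_ne hv _ _
  have hdB : ∀ v ∈ B', d v ∈ C \ A := by
    intro v hv
    rw [hdc v (ne_of_mem_erase hv)]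
    exact mem_sdiff.2 ⟨hc v (hB'S hv), hB'A v hv⟩
  have hcA : ∀ v ∈ S, v ≠ y → v ∉ B' → c v ∈ A := by
    intro v hvS hvy hv
    by_contra h
    exact hv (mem_erase.2 ⟨hvy, mem_filter.2 ⟨hvS, h⟩⟩)
  have hdA : ∀ v ∈ S, v ∉ B' → d v ∈ A := by
    intro v hvS hv
    by_cases hvy : v = y
    · rw [hvy, hdy]
      exact hzA
    · rw [hdc v hvy]
      exact hcA v hvS hvy hv
  have hdA' : ∀ v ∈ S, v ∉ B' → d v ∉ C \ A := fun v hv hv' h =>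
    (mem_sdiff.1 h).2 (hdA v hv hv')
  set h := glue B' g d with hh
  have hhB : ∀ v ∈ B', h v = g v := fun v hv => if_pos hv
  have hhd : ∀ v, v ∉ B' → h v = d v := fun v hv => if_neg hv
  set f := Function.update h z Y with hfdef
  have hfz : f z = Y := Function.update_self _ _ _
  have hfh : ∀ v, v ≠ z → f v = h v := fun v hv => Function.update_of_ne hv _ _
  have hfB : ∀ v ∈ B', f v = g v := fun v hv => by
    rw [hfh v (fun e => hzB' (e ▸ hv)), hhB v hv]
  have hfy : f y = c z := by rw [hfh y hzy.symm, hhd y hyB', hdy]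
  have hfc : ∀ v, v ≠ z → v ≠ y → v ∉ B' → f v = c v := fun v h1 h2 h3 => by
    rw [hfh v h1, hhd v h3, hdc v h2]
  have hcls : ∀ X ∈ A, X ≠ c z → ∀ v ∈ S, f v = X ↔ c v = X := by
    intro X hX hXz v hv
    by_cases h1 : v = z
    · rw [h1, hfz]
      exact ⟨fun e => absurd (e ▸ hX) hYA, fun e => absurd e.symm hXz⟩
    by_cases h2 : v = y
    · rw [h2, hfy]
      exact ⟨fun e => absurd e.symm hXz, fun e => absurd (e ▸ hX) hyA⟩
    by_cases h3 : v ∈ B'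
    · rw [hfB v h3]
      exact ⟨fun e => absurd (e ▸ hX) (hgA v h3), fun e => absurd (e ▸ hX) (hB'A v h3)⟩
    · rw [hfc v h1 h2 h3]
  have hfree : ∀ X ∈ A, X ≠ c z → ∀ v, Free G S c v X → Free G S f v X :=
    fun X hX hXz v hv w hw hvw e => hv w hw hvw ((hcls X hX hXz w hw).1 e)
  have hreach : ∀ x, x ≠ c z → ReflTransGen (Avoid (Mov G S C c) (c z)) x a →
      ReflTransGen (Mov G S C f) x a := by
    intro x _ hx
    induction hx using ReflTransGen.head_induction_on with
    | refl => exact .refl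
    | @head i k hik hka ih =>
      have hk : k ∈ A := (mem_acc ha).2 (ReflTransGen.of_avoid hka)
      have hi : i ∈ A := (mem_acc ha).2 (.head hik.1 (ReflTransGen.of_avoid hka))
      obtain ⟨⟨hiC, hkC, w, hw, hwi, hwk⟩, h1, h2⟩ := hik
      exact .head ⟨hiC, hkC, w, hw, (hcls i hi h1 w hw).2 hwi, hfree k hk h2 w hwk⟩ (ih h2)
  -- No arc from `c z` to another colour of `A` is witnessed by `z` itself, so the departure of `z`
  -- does not break it.
  have hreachz : ReflTransGen (Mov G S C f) (c z) a := by
    rcases reach_avoid_or (c z) ((mem_acc ha).1 hzA) with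
      h | h | ⟨k, hk, ⟨hzC, hkC, w, hw, hwz, hwk⟩, h⟩
    · rcases ReflTransGen.cases_head h with h | ⟨_, h, _⟩
      · exact absurd h hza
      · exact absurd rfl h.2.1
    · exact absurd h hza
    · have hkA : k ∈ A := (mem_acc ha).2 (ReflTransGen.of_avoid h)
      have hwz' : w ≠ z := by
        rintro rfl
        exact hf k hkA hk hwk
      refine .head ⟨hzC, hkC, w, hw, ?_, hfree k hkA hk w hwk⟩ (hreach k hk h)
      rw [hfc w hwz' (fun e => hyA (by rw [← e, hwz]; exact hzA))
        (fun e => hB'A w e (by rw [hwz]; exact hzA)), hwz]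
  have hfC : ∀ v ∈ S, f v ∈ C := by
    intro v hv
    by_cases h1 : v = z
    · rw [h1, hfz]
      exact (mem_sdiff.1 hY).1
    · rw [hfh v h1]
      by_cases h2 : v ∈ B'
      · rw [hhB v h2]
        exact (mem_sdiff.1 (hg.1 v h2)).1
      · rw [hhd v h2]
        exact hAC (hdA v hv h2)
  -- The only neighbour `z` of `y'` in class `c z` has left, and the newcomer `y` is not adjacent to
  -- `y'`.
  have hreachy : ReflTransGen (Mov G S C f) (g y') a := by
    have hgy : g y' ∈ C := (mem_sdiff.1 (hg.1 y' hy'B')).1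
    refine .head ⟨hgy, hAC hzA, y', hyS', hfB y' hy'B', fun w hw hyw e => ?_⟩ hreachz
    have h1 : w ≠ z := by
      rintro rfl
      exact hYA (by rw [← hfz, e]; exact hzA)
    have h2 : w ≠ y := by
      rintro rfl
      exact hadj hyw.symm
    have h3 : w ∉ B' := fun h => hgA w h (by rw [← hfB w h, e]; exact hzA)
    rw [hfc w h1 h2 h3] at e
    exact h1 (hyu' w hw hyw e)
  refine ⟨f, Y, (mem_sdiff.1 hY).1, hfC, ?_, fun x hx => ?_, card_lt_card ?_⟩
  · refine ProperOn.update_of_erase (ProperOn.glue (B := C \ A) (ProperOn.update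
      (fun v hv w hw => hp v (mem_of_mem_erase hv) w (mem_of_mem_erase hw)) ?_) hg.2.1 hg.1 ?_) ?_
    · intro w hw hyw e
      exact (mem_erase.1 hw).1 (hyu w (mem_erase.1 hw).2 hyw e)
    · exact fun v hv => hdA' v (mem_of_mem_erase hv)
    · intro w hw hzw e
      by_cases h1 : w ∈ B'
      · exact hYf w h1 hzw ((hhB w h1).symm.trans e)
      · have h2 : h w ∈ A := by
          rw [hhd w h1]
          exact hdA w hw h1
        exact hYA (e ▸ h2)
  · have e1 := card_cls_update h hz Y x
    rw [hhd z hzB', hdc z hzy, ← hfdef] at e1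
    by_cases hxA : x ∈ A
    · rw [cls_glue_of_notMem hg.1 hdB (fun h => (mem_sdiff.1 h).2 hxA)] at e1
      have e2 := card_cls_update c hyS (c z) x
      have e3 := hs x hx
      have hxb : x ≠ b := fun h => hbA (h ▸ hxA)
      have hxy : x ≠ c y := fun h => hyA (h ▸ hxA)
      rw [if_neg hxy, ← hd] at e2
      rw [if_neg hxb] at e3
      omega
    · have hxz : x ≠ c z := fun h => hxA (h ▸ hzA)
      have hxa : x ≠ a := fun h => hxA (h ▸ (mem_acc ha).2 .refl)
      rw [cls_glue_of_mem hB'S hdA' (mem_sdiff.2 ⟨hx, hxA⟩), if_neg hxz,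
        hg.2.2 x (mem_sdiff.2 ⟨hx, hxA⟩)] at e1
      rw [if_neg hxa]
      omega
  · refine (ssubset_iff_of_subset fun i hi => ?_).2 ⟨g y', hg.1 y' hy'B',
      fun h => (mem_sdiff.1 h).2 ((mem_acc ha).2 hreachy)⟩
    obtain ⟨hiC, hiA⟩ := mem_sdiff.1 hi
    refine mem_sdiff.2 ⟨hiC, fun h => hiA ((mem_acc ha).2 ?_)⟩
    by_cases hiz : i = c z
    · exact hiz ▸ hreachz
    · exact hreach i hiz (hr i h hiz)

/-- Induction on the number of colours that do not reach `a`; `IH` recolours the vertices outside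
`A` other than `y`. -/
theorem exists_isEquitable_of_near (hdeg : ∀ v ∈ S, #(S.filter (G.Adj v)) < #C)
    (IH : ∀ (S' : Finset V) (C' : Finset κ), S' ⊂ S → #S' = #C' * s →
      (∀ v ∈ S', #(S'.filter (G.Adj v)) < #C') → ∃ g : V → κ, IsEquitable G S' C' s g)
    (ha : a ∈ C) :
    ∀ (n : ℕ) (c : V → κ) (b : κ), #(C \ acc G S C c a) < n → (∀ v ∈ S, c v ∈ C) →
      ProperOn G S c → b ∈ C →
      (∀ i ∈ C, #(cls S c i) + (if i = a then 1 else 0) = s + if i = b then 1 else 0) →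
      ∃ c' : V → κ, IsEquitable G S C s c' := by
  intro n
  induction n with
  | zero => exact fun _ _ h => absurd h (Nat.not_lt_zero _)
  | succ n ih =>
    intro c b hn hc hp hb hs
    by_cases hbA : b ∈ acc G S C c a
    · exact exists_isEquitable_of_mem_acc hc hp ha hbA hs
    set A := acc G S C c a with hAdef
    have hAC : A ⊆ C := filter_subset _ _
    have haA : a ∈ A := (mem_acc ha).2 .refl
    have hCA : #C = #A + #(C \ A) := by
      have := card_sdiff_add_card_eq_card hAC
      omega
    have hcl : ∀ x y, Mov G S C c x y → y ∈ A → x ∈ A := fun x y hxy hy =>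
      (mem_acc ha).2 (((mem_acc ha).1 hy).head hxy)
    have hB : ∀ y ∈ S, c y ∉ A → ∀ i ∈ A, ¬ Free G S c y i := fun y hy hyA i hi hf =>
      hyA (hcl _ i ⟨hc y hy, hAC hi, y, hy, rfl, hf⟩ hi)
    obtain ⟨U, hU, T, hTA, hTne, hUT, haT, hterm, hout⟩ := exists_terminal_block
      (fun x => mem_acc ha) (exists_acc_ne hdeg hc hs hAC haA hb hbA hB)
    have hBc := card_filter_notMem_acc hc hs haA hb hbA
    have hdeg' : ∀ v ∈ S, #(S.filter (G.Adj v)) < #A + #(C \ A) := by rwa [← hCA]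
    obtain ⟨z, hz, hzT, y, hsp, hzy⟩ := exists_solo hdeg' hTA hTne hU hUT hB
      (fun x hx hxT i hi hiT hiU hf =>
        hout _ hxT i hi hiT hiU ⟨hc x hx, hAC hi, x, hx, rfl, hf⟩)
      (by rw [hBc]; exact Nat.lt_succ_self _)
      (fun W hW => by
        have h1 : W ≠ a := fun h => haT (h ▸ hW)
        have h2 : W ≠ b := fun h => hbA (hTA (h ▸ hW))
        have := hs W (hAC (hTA hW))
        rw [if_neg h1, if_neg h2] at this
        exact this)
    have hyB : y ∈ S.filter fun v => c v ∉ A := mem_filter.2 ⟨hsp.1, hsp.2.1⟩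
    obtain ⟨g, hg⟩ := IH ((S.filter fun v => c v ∉ A).erase y) (C \ A)
      ((ssubset_iff_of_subset ((erase_subset _ _).trans (filter_subset _ _))).2
        ⟨y, hsp.1, notMem_erase _ _⟩)
      (by rw [card_erase_of_mem hyB, hBc]; rfl)
      (fun v hv => by
        obtain ⟨hvS, hvA⟩ := mem_filter.1 (mem_of_mem_erase hv)
        refine lt_of_le_of_lt (card_le_card fun w hw => ?_) (outDeg_lt hdeg' hB hvS hvA)
        obtain ⟨hw1, hw2⟩ := mem_filter.1 hw
        obtain ⟨hwS, hwA⟩ := mem_filter.1 (mem_of_mem_erase hw1)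
        exact mem_filter.2 ⟨hwS, hw2, hwA⟩)
    rcases hzy with ⟨X, hX, hXz, hf⟩ | ⟨hf, y', hsp', hyy, hadj⟩
    · exact exists_isEquitable_of_swap hc hp hs hAC hbA hcl haA hz (hTA hzT) hsp hXz hf
        (hterm _ hzT X hX hXz) hg
    · obtain ⟨c', b', hb', hc', hp', hs', hlt⟩ := exists_near_of_not_free hdeg hc hp ha hs hbA hz
        (hTA hzT) (fun h => haT (h ▸ hzT)) hsp hsp' hyy hadj hf (hterm _ hzT) hg
      exact ih c' b' (hlt.trans_le (Nat.lt_succ_iff.1 hn)) hc' hp' hb' hs'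

end Near

/-! ### The Hajnal–Szemerédi theorem -/

/-- The number of pairs of adjacent vertices in `S`. -/
noncomputable def adjPairs (G : SimpleGraph V) (S : Finset V) : Finset (V × V) :=
  (S ×ˢ S).filter fun p => G.Adj p.1 p.2

theorem exists_equitable_of_card [Nonempty κ] (n : ℕ) :
    ∀ (G : SimpleGraph V) (S : Finset V) (C : Finset κ) (s : ℕ), #S + #(adjPairs G S) < n →
      #S = #C * s → (∀ v ∈ S, #(S.filter (G.Adj v)) < #C) →
      ∃ c : V → κ, IsEquitable G S C s c := by
  induction n with
  | zero => exact fun _ _ _ _ h => absurd h (Nat.not_lt_zero _)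
  | succ n ih =>
    intro G S C s hn hS hdeg
    by_cases hne : ∃ u ∈ S, ∃ v ∈ S, G.Adj u v
    · obtain ⟨u, hu, v, hv, huv⟩ := hne
      obtain ⟨G', hG'⟩ : ∃ G' : SimpleGraph V, G' = G.deleteEdges {s(u, v)} := ⟨_, rfl⟩
      have hle : G' ≤ G := hG' ▸ SimpleGraph.deleteEdges_le _
      have hG'adj : ∀ x y, G.Adj x y → s(x, y) ≠ s(u, v) → G'.Adj x y := fun x y h1 h2 =>
        hG' ▸ SimpleGraph.deleteEdges_adj.2 ⟨h1, h2⟩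
      have hlt : #(adjPairs G' S) < #(adjPairs G S) := by
        refine card_lt_card ((ssubset_iff_of_subset fun p hp => ?_).2 ⟨(u, v), ?_, ?_⟩)
        · obtain ⟨h1, h2⟩ := mem_filter.1 hp
          exact mem_filter.2 ⟨h1, hle h2⟩
        · exact mem_filter.2 ⟨mem_product.2 ⟨hu, hv⟩, huv⟩
        · exact fun h => (SimpleGraph.deleteEdges_adj.1 (hG' ▸ (mem_filter.1 h).2)).2 rfl
      obtain ⟨c, hc, hp, hs⟩ := ih G' S C s (by omega) hS fun w hw =>
        (card_le_card (monotone_filter_right _ fun x _ hx => hle hx)).trans_lt (hdeg w hw)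
      by_cases hcuv : c u = c v
      -- Restoring the edge creates a conflict only at `u` and `v`. Moving `u` to a colour `j`
      -- unused on its neighbours leaves its old class one short and class `j` one over.
      · have hfree : ∃ j ∈ C, Free G S c u j := by
          have h : #((S.filter (G.Adj u)).image c) < #C := card_image_le.trans_lt (hdeg u hu)
          obtain ⟨j, hj, hj'⟩ := exists_mem_notMem_of_card_lt_card h
          exact ⟨j, hj, fun w hw huw e => hj' (mem_image.2 ⟨w, mem_filter.2 ⟨hw, huw⟩, e⟩)⟩
        obtain ⟨j, hj, hf⟩ := hfree
        refine exists_isEquitable_of_near (a := c u) hdeg (fun S' C' hS' h1 h2 =>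
          ih G S' C' s ?_ h1 h2) (hc u hu) _ (Function.update c u j) j (Nat.lt_succ_self _) ?_ ?_ hj
          fun i hi => ?_
        · have h1 := card_lt_card hS'
          have h2 : #(adjPairs G S') ≤ #(adjPairs G S) :=
            card_le_card (filter_subset_filter _ (product_subset_product hS'.1 hS'.1))
          omega
        · intro w hw
          by_cases hwu : w = u
          · rw [hwu, Function.update_self]
            exact hj
          · rw [Function.update_of_ne hwu]
            exact hc w hw
        · refine ProperOn.update_of_erase (fun x hx y hy hxy => ?_) hf
          obtain ⟨hxu, hx⟩ := mem_erase.1 hx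
          obtain ⟨hyu, hy⟩ := mem_erase.1 hy
          refine hp x hx y hy (hG'adj x y hxy fun e => ?_)
          rcases Sym2.eq_iff.1 e with ⟨h, -⟩ | ⟨-, h⟩
          · exact hxu h
          · exact hyu h
        · have e1 := card_cls_update c hu j i
          rw [hs i hi] at e1
          exact e1
      · refine ⟨c, hc, fun x hx y hy hxy => ?_, hs⟩
        by_cases e : s(x, y) = s(u, v)
        · rcases Sym2.eq_iff.1 e with ⟨rfl, rfl⟩ | ⟨rfl, rfl⟩
          · exact hcuv
          · exact fun h => hcuv h.symm
        · exact hp x hx y hy (hG'adj x y hxy e)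
    · push Not at hne
      have h := card_product C (range s)
      rw [card_range, ← hS] at h
      -- Without edges, any bijection from `S` to `C ×ˢ range s` gives the colouring; values off `S`
      -- are irrelevant.
      let e := Finset.equivOfCardEq h.symm
      refine ⟨fun v => if hv : v ∈ S then (e ⟨v, hv⟩).1.1 else Classical.arbitrary κ,
        fun v hv => ?_, fun x hx y hy hxy => absurd hxy (hne x hx y hy), fun i hi => ?_⟩
      · simp only [dif_pos hv]
        exact (mem_product.1 (e ⟨v, hv⟩).2).1
      · refine Eq.trans ?_ (card_range s)
        refine card_bij' (fun v hv => (e ⟨v, (mem_cls.1 hv).1⟩).1.2)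
          (fun k hk => (e.symm ⟨(i, k), mem_product.2 ⟨hi, hk⟩⟩).1) ?_ ?_ ?_ ?_
        · exact fun v hv => (mem_product.1 (e ⟨v, (mem_cls.1 hv).1⟩).2).2
        · intro k hk
          refine mem_cls.2 ⟨(e.symm _).2, ?_⟩
          simp
        · intro v hv
          obtain ⟨hvS, hvi⟩ := mem_cls.1 hv
          simp only [dif_pos hvS] at hvi
          subst hvi
          simp
        · intro k hk
          simp

/-- The **Hajnal–Szemerédi theorem**: if every vertex of `S` has fewer than `#C` neighbours in `S`,
and `#S = #C * s`, then `S` has a proper colouring in which each colour of `C` is used `s` times. -/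
theorem hajnal_szemeredi [Nonempty κ] {G : SimpleGraph V} {S : Finset V} {C : Finset κ} {s : ℕ}
    (hS : #S = #C * s) (hdeg : ∀ v ∈ S, #(S.filter (G.Adj v)) < #C) :
    ∃ c : V → κ, IsEquitable G S C s c :=
  exists_equitable_of_card _ G S C s (Nat.lt_succ_self _) hS hdeg

end EquitableColoring

/-! ### Tilings from clique partitions -/

namespace EdgeOrderedGraph

open Finset
open scoped Classical

variable {W V : Type*} {F : EdgeOrderedGraph W} {G : EdgeOrderedGraph V}

/-- The set `S` is the disjoint union of the vertex sets of copies of `F` in `G`. -/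
def TilesSet (F : EdgeOrderedGraph W) (G : EdgeOrderedGraph V) (S : Set V) : Prop :=
  ∃ 𝒯 : Set G.graph.Subgraph, IsTiling F G 𝒯 ∧ ∀ v, v ∈ S ↔ ∃ H ∈ 𝒯, v ∈ H.verts

theorem TilesSet.iUnion {ι : Type*} {S : ι → Set V} (hS : ∀ i, TilesSet F G (S i))
    (hd : Pairwise fun i j => Disjoint (S i) (S j)) : TilesSet F G (⋃ i, S i) := by
  choose 𝒯 h𝒯 hv using hS
  refine ⟨⋃ i, 𝒯 i, ⟨fun H hH => ?_, fun H hH H' hH' hne => ?_⟩, fun v => ?_⟩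
  · obtain ⟨i, hi⟩ := Set.mem_iUnion.1 hH
    exact (h𝒯 i).1 H hi
  · obtain ⟨i, hi⟩ := Set.mem_iUnion.1 hH
    obtain ⟨j, hj⟩ := Set.mem_iUnion.1 hH'
    by_cases hij : i = j
    · subst hij
      exact (h𝒯 i).2 hi hj hne
    · exact (hd hij).mono (fun v hv' => (hv i v).2 ⟨H, hi, hv'⟩)
        (fun v hv' => (hv j v).2 ⟨H', hj, hv'⟩)
  · simp only [Set.mem_iUnion, hv]
    exact ⟨fun ⟨i, H, hH, hv⟩ => ⟨H, ⟨i, hH⟩, hv⟩, fun ⟨H, ⟨i, hH⟩, hv⟩ => ⟨i, H, hH, hv⟩⟩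

theorem TilesSet.union {S S' : Set V} (hS : TilesSet F G S) (hS' : TilesSet F G S')
    (hd : Disjoint S S') : TilesSet F G (S ∪ S') := by
  rw [Set.union_eq_iUnion]
  refine TilesSet.iUnion (fun b => by cases b <;> assumption) ?_
  intro i j hij
  cases i <;> cases j <;> first | exact absurd rfl hij | exact hd | exact hd.symm

theorem IsCopy.tilesSet {H : G.graph.Subgraph} (hH : IsCopy F G H) : TilesSet F G H.verts :=
  ⟨{H}, ⟨by simpa using hH, Set.pairwiseDisjoint_singleton _ _⟩, by simp⟩

theorem verts_toSubgraph {A : SimpleGraph W} {B : SimpleGraph V} (φ : SimpleGraph.Copy A B) :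
    φ.toSubgraph.verts = Set.range φ := by
  simp [SimpleGraph.Copy.toSubgraph]

theorem IsCopy.ncard_verts [Fintype W] {H : G.graph.Subgraph} (hH : IsCopy F G H) :
    H.verts.ncard = Fintype.card W := by
  obtain ⟨φ, -, rfl⟩ := hH
  rw [verts_toSubgraph, ← Set.image_univ,
    Set.ncard_image_of_injective _ (show Function.Injective φ from φ.injective),
    Set.ncard_univ, Nat.card_eq_fintype_card]

theorem tilesSet_of_isClique [Fintype W] {S : Finset V} (hS : G.graph.IsClique S)
    (hcard : #S ∈ tilingOrders F) : TilesSet F G S := by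
  let e := S.equivFin.symm
  let ψ : SimpleGraph.Copy (⊤ : SimpleGraph (Fin #S)) G.graph :=
    ⟨⟨fun i => (e i).1, fun {i j} hij => hS (e i).2 (e j).2
      fun h => hij (e.injective (Subtype.ext h))⟩,
      fun i j h => e.injective (Subtype.ext h)⟩
  have hψ : Set.range ψ = S := by
    ext v
    constructor
    · rintro ⟨i, rfl⟩
      exact (e i).2
    · intro hv
      exact ⟨e.symm ⟨v, hv⟩, congrArg Subtype.val (e.apply_symm_apply ⟨v, hv⟩)⟩
  -- The edge order of `G` is pulled back along an enumeration of the clique; a tiling of `K` is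
  -- then pushed forward by `ψ`.
  let K : EdgeOrderedGraph (Fin #S) :=
    { graph := ⊤
      edgeOrder := letI := G.edgeOrder
        LinearOrder.lift' ψ.toHom.mapEdgeSet
          (SimpleGraph.Hom.mapEdgeSet.injective _ ψ.injective) }
  obtain ⟨𝒯, ⟨h1, h2⟩, h3⟩ := hcard.2.2 K rfl
  have hverts : ∀ H : K.graph.Subgraph, (H.map ψ.toHom).verts = ψ '' H.verts := fun H => rfl
  refine ⟨(fun H : K.graph.Subgraph => H.map ψ.toHom) '' 𝒯, ⟨?_, ?_⟩, fun v => ?_⟩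
  · rintro _ ⟨H, hH, rfl⟩
    obtain ⟨φ, hφ, rfl⟩ := h1 H hH
    refine ⟨ψ.comp φ, fun x y hxy => ?_, ?_⟩
    · have hc : ∀ x, (ψ.comp φ).toHom.mapEdgeSet x = ψ.toHom.mapEdgeSet (φ.toHom.mapEdgeSet x) :=
        fun x => Subtype.ext (Sym2.map_map (f := φ) (g := ψ) x.1).symm
      rw [hc, hc]
      exact hφ x y hxy
    · change SimpleGraph.Subgraph.map _ ⊤ = SimpleGraph.Subgraph.map _ (SimpleGraph.Subgraph.map _ ⊤)
      rw [← SimpleGraph.Subgraph.map_comp]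
      rfl
  · rintro _ ⟨H, hH, rfl⟩ _ ⟨H', hH', rfl⟩ hne
    have := h2 hH hH' (fun h => hne (h ▸ rfl))
    exact Set.disjoint_image_of_injective ψ.injective this
  · rw [← hψ]
    constructor
    · rintro ⟨i, rfl⟩
      obtain ⟨H, hH, hi⟩ := h3 i
      exact ⟨_, ⟨H, hH, rfl⟩, i, hi, rfl⟩
    · rintro ⟨_, ⟨H, hH, rfl⟩, i, -, rfl⟩
      exact ⟨i, rfl⟩

/-- The classes of a proper colouring of the complement are cliques. -/
theorem exists_clique_partition {H : SimpleGraph V} {S : Finset V} {k t : ℕ} (hS : #S = k * t)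
    (hdeg : ∀ v ∈ S, #(S.filter (Hᶜ.Adj v)) < k) :
    ∃ P : Fin k → Finset V, (∀ i, #(P i) = t ∧ H.IsClique (P i)) ∧
      (Pairwise fun i j => Disjoint (P i) (P j)) ∧ ∀ v, v ∈ S ↔ ∃ i, v ∈ P i := by
  rcases k.eq_zero_or_pos with rfl | hk
  · have : S = ∅ := card_eq_zero.1 (by simpa using hS)
    subst this
    exact ⟨fun _ => ∅, fun i => i.elim0, fun i => i.elim0, by simp⟩
  have : Nonempty (Fin k) := ⟨⟨0, hk⟩⟩
  obtain ⟨c, -, hp, hs⟩ := EquitableColoring.hajnal_szemeredi (κ := Fin k) (G := Hᶜ) (S := S)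
    (C := univ) (s := t) (by simpa using hS) (by simpa using hdeg)
  refine ⟨fun i => EquitableColoring.cls S c i, fun i => ⟨hs i (mem_univ _), ?_⟩, ?_, fun v => ?_⟩
  · intro v hv w hw hvw
    obtain ⟨hv, hvi⟩ := EquitableColoring.mem_cls.1 hv
    obtain ⟨hw, hwi⟩ := EquitableColoring.mem_cls.1 hw
    by_contra h
    exact hp v hv w hw ((SimpleGraph.compl_adj _ _ _).2 ⟨hvw, h⟩) (hvi.trans hwi.symm)
  · intro i j hij
    refine disjoint_left.2 fun v hv hw => hij ?_
    exact (EquitableColoring.mem_cls.1 hv).2.symm.trans (EquitableColoring.mem_cls.1 hw).2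
  · simp [EquitableColoring.mem_cls]

/-- With `k` fixed, each of the `j` rounds removes a single copy of `F`, and the complement degree
bound survives. The last `k * t` vertices split into cliques that are tiled completely. -/
theorem tilesSet_of_card [Fintype W] {k t : ℕ} (ht : t ∈ tilingOrders F) (hk : 0 < k) (j : ℕ) :
    ∀ S : Finset V, #S = k * t + j * Fintype.card W →
      (∀ v ∈ S, #(S.filter (G.graphᶜ.Adj v)) < k) → TilesSet F G S := by
  induction j with
  | zero =>
    intro S hS hdeg
    obtain ⟨P, hP, hd, hv⟩ := exists_clique_partition (by simpa using hS) hdeg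
    have : (S : Set V) = ⋃ i, (P i : Set V) := by
      ext v
      simp [hv]
    rw [this]
    refine TilesSet.iUnion (fun i => tilesSet_of_isClique (hP i).2 ((hP i).1.symm ▸ ht)) ?_
    exact fun i j hij => disjoint_coe.2 (hd hij)
  | succ j ih =>
    intro S hS hdeg
    obtain ⟨S', hS', hcard⟩ := exists_subset_card_eq (s := S) (n := k * t) (by omega)
    obtain ⟨P, hP, hd, hv⟩ := exists_clique_partition hcard fun v hv =>
      (card_le_card (filter_subset_filter _ hS')).trans_lt (hdeg v (hS' hv))
    -- One clique is tiled only to find a single copy `H`; the rest of the partition and tiling is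
    -- discarded.
    have ⟨hP0, hPc⟩ := hP ⟨0, hk⟩
    obtain ⟨𝒯, h𝒯, hv𝒯⟩ := tilesSet_of_isClique (F := F) hPc (hP0.symm ▸ ht)
    obtain ⟨u, hu⟩ : (P ⟨0, hk⟩).Nonempty := card_pos.1 (hP0.symm ▸ ht.1)
    obtain ⟨H, hH, -⟩ := (hv𝒯 u).1 hu
    have hHS : H.verts ⊆ S := fun v hvH => hS' ((hv v).2 ⟨_, (hv𝒯 v).2 ⟨H, hH, hvH⟩⟩)
    have hfin : H.verts.Finite := S.finite_toSet.subset hHS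
    have hHcard := (h𝒯.1 H hH).ncard_verts
    rw [Set.ncard_eq_toFinset_card _ hfin] at hHcard
    have hsub : hfin.toFinset ⊆ S := fun v hv => hHS (hfin.mem_toFinset.1 hv)
    have hrest := ih (S \ hfin.toFinset) (by
        rw [card_sdiff_of_subset hsub, hS, hHcard, Nat.add_mul]
        omega)
      fun v hv => (card_le_card (filter_subset_filter _ sdiff_subset)).trans_lt
        (hdeg v (mem_sdiff.1 hv).1)
    have := (h𝒯.1 H hH).tilesSet.union hrest (by
      rw [coe_sdiff, hfin.coe_toFinset]
      exact Set.disjoint_sdiff_right)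
    rwa [coe_sdiff, hfin.coe_toFinset, Set.union_sdiff_cancel hHS] at this

end EdgeOrderedGraph

theorem theorem1p6 {W : Type*} [Fintype W] [Nonempty W] (F : EdgeOrderedGraph W)
    (hF : F.Tileable) (n : ℕ) (hn : F.tilingNumber ≤ n) (hdvd : Fintype.card W ∣ n)
    {V : Type*} [Fintype V] (hV : Fintype.card V = n) (G : EdgeOrderedGraph V)
    [DecidableRel G.graph.Adj]
    (hG : (1 - 1 / (F.tilingNumber : ℝ)) * (n : ℝ) ≤ (G.graph.minDegree : ℝ)) :
    EdgeOrderedGraph.HasPerfectTiling F G := by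
  classical
  set t := F.tilingNumber with htdef
  have ht : t ∈ F.tilingOrders := Nat.sInf_mem hF
  have htpos : 0 < t := ht.1
  have hk : 0 < n / t := Nat.div_pos hn htpos
  obtain ⟨j, hj⟩ : Fintype.card W ∣ n % t := (Nat.dvd_mod_iff ht.2.1).2 hdvd
  -- The bound passes to the floor `n / t` because the left side is an integer. Since `v` is not its
  -- own non-neighbour, the complement degree is strictly below `n / t`.
  have hdeg : ∀ v, n - G.graph.degree v ≤ n / t := by
    intro v
    rw [Nat.le_div_iff_mul_le htpos]
    have h1 : (G.graph.minDegree : ℝ) ≤ G.graph.degree v := by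
      exact_mod_cast G.graph.minDegree_le_degree v
    have h2 : G.graph.degree v ≤ n := by
      rw [← hV]
      exact (G.graph.degree_lt_card_verts v).le
    have h3 : (0 : ℝ) < t := by exact_mod_cast htpos
    have h4 : ((n : ℝ) - G.graph.degree v) * t ≤ n := by
      have h5 : (n : ℝ) - G.graph.degree v ≤ n / t := by
        have : (1 - 1 / (t : ℝ)) * n = n - n / t := by ring
        linarith
      exact (le_div_iff₀ h3).1 h5
    rw [← Nat.cast_sub h2] at h4
    exact_mod_cast h4
  obtain ⟨𝒯, h1, h2⟩ := EdgeOrderedGraph.tilesSet_of_card (G := G) ht hk j Finset.univ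
    (by rw [Finset.card_univ, hV, mul_comm j, ← hj, mul_comm, Nat.div_add_mod])
    (fun v _ => by
      have h1 := G.graph.degree_compl v
      have h2 := hdeg v
      have h3 := G.graph.degree_lt_card_verts v
      have h4 : (Finset.univ.filter (G.graphᶜ.Adj v)).card = G.graphᶜ.degree v := by
        rw [← SimpleGraph.card_neighborFinset_eq_degree]
        congr 1
        ext w
        simp
      rw [hV] at h1 h3
      convert (by omega : G.graphᶜ.degree v < n / t) using 1
      convert h4)
  exact ⟨𝒯, h1, fun v => (h2 v).1 (by simp)⟩
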